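/- Let $\mathbb K$ be a field of characteristic zero and let $L$ be a right pre-Lie algebra over $\mathbb K$: a $\mathbb K$-vector space with a bilinear product $\curvearrowleft$ such that $$(x\curvearrowleft y)\curvearrowleft z-x\curvearrowleft(y\curvearrowleft z)=(x\curvearrowleft z)\curvearrowleft y-x\curvearrowleft(z\curvearrowleft y)\qquad\text{for all }x,y,z\in L.$$ Let $S(L)$ be the symmetric algebra of $L$, with the coproduct $\Delta B=B_1\otimes B_2$ (Sweedler notation) and counit $\varepsilon$ for which the elements of $L$ are primitive. Extend $\curvearrowleft$ bilinearly to $S(L)$ in the manner of Guin and Oudom: for $l,x\in L$ and $A,A',B\in S(L)$, $$l\curvearrowleft 1=l,\qquad l\curvearrowleft(Bx)=(l\curvearrowleft B)\curvearrowleft x-l\curvearrowleft(B\curvearrowleft x),\qquad 1\curvearrowleft B=\varepsilon(B)1,\qquad AA'\curvearrowleft B=(A\curvearrowleft B_1)(A'\curvearrowleft B_2),$$ and let $A\ast B:=(A\curvearrowleft B_1)B_2$ be the Guin–Oudom product, which is associative with unit $1$ and makes $(S(L),\ast)$ the enveloping algebra of $L$. Then for all $n\ge 0$ and all $l_1,\dots,l_n\in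 L$, the commutative product $l_1\cdots l_n$ in $S(L)$ satisfies $$l_1\cdots l_n=\sum_{P_1,\dots,P_k}(-1)^{n-k}\,l_{P_1}\ast\cdots\ast l_{P_k}.$$ Here the sum runs over all partitions $\{P_1,\dots,P_k\}$ of $[n]=\{1,\dots,n\}$ into nonempty blocks, each numbered so that $\max P_1<\cdots<\max P_k$, and for a block $P_i=\{p_1<\cdots<p_h\}$ $$l_{P_i}:=\sum_{\sigma\in S_{h-1}} l_{p_{\sigma(1)}}\curvearrowleft\bigl(l_{p_{\sigma(2)}}\curvearrowleft(\cdots\curvearrowleft(l_{p_{\sigma(h-1)}}\curvearrowleft l_{p_h})\cdots)\bigr).$$ (For $n=0$ both sides are $1$.) -/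

import Mathlib

noncomputable section

namespace PreLie

section Lists

variable {L W : Type*}

/-- `∑ i, φ (B with its i-th entry b replaced by b ↶ x)`: the right action of `x` on a word `B` as
a derivation, followed by `φ`. -/
def replaceSum [Mul L] [AddCommMonoid W] (x : L) : List L → (List L → W) → W
  | [], _ => 0
  | b :: B, φ => φ ((b * x) :: B) + replaceSum x B (fun C => φ (b :: C))

variable (k : Type*) [CommRing k] [RightPreLieRing L] [RightPreLieAlgebra k L]

/-- The braces of words of length at most `n`, as endomorphisms of `L` (and `0` on longer words),
by recursion on `n`. -/
def braceAux : ℕ → List L → Module.End k L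
  | _, [] => 1
  | 0, _ :: _ => 0
  | n + 1, x :: B => LinearMap.mulRight k x ∘ₗ braceAux n B - replaceSum x B (braceAux n)

/-- The brace `l ↦ l ↶ (x₁ ⋯ xₙ)` of a word, characterised by `l ↶ 1 = l` and
`l ↶ (x B) = (l ↶ B) ↶ x - l ↶ (B ↶ x)`. -/
def braceList (B : List L) : Module.End k L := braceAux k B.length B

theorem replaceSum_congr [AddCommMonoid W] (x : L) (B : List L) :
    ∀ (φ ψ : List L → W), (∀ C, C.length = B.length → φ C = ψ C) →
      replaceSum x B φ = replaceSum x B ψ := by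
  induction B with
  | nil => intro φ ψ _; rfl
  | cons b B ih =>
    intro φ ψ h
    simp only [replaceSum]
    rw [h _ (by simp), ih _ _ (fun C hC => h _ (by simp [hC]))]

theorem braceAux_eq (n : ℕ) : ∀ B : List L, B.length ≤ n → braceAux k n B = braceList k B := by
  induction n with
  | zero =>
    intro B hB
    obtain rfl : B = [] := List.length_eq_zero_iff.1 (by omega)
    rfl
  | succ n ih =>
    intro B hB
    cases B with
    | nil => rfl
    | cons x B =>
      have hB' : B.length ≤ n := by simpa using hB
      have h : ∀ C : List L, C.length = B.length →
          braceAux k n C = braceAux k B.length C := by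
        intro C hC
        rw [ih C (by omega), braceList, hC]
      simp only [braceList, List.length_cons, braceAux]
      rw [h B rfl, replaceSum_congr x B _ _ h]

theorem braceList_nil : braceList k ([] : List L) = 1 := rfl

theorem braceList_cons (x : L) (B : List L) :
    braceList k (x :: B) =
      LinearMap.mulRight k x ∘ₗ braceList k B - replaceSum x B (braceList k) := by
  conv_lhs => rw [braceList, List.length_cons, braceAux]
  rw [braceAux_eq k _ B le_rfl,
    replaceSum_congr x B _ _ (fun C hC => braceAux_eq k _ C (le_of_eq hC))]

theorem replaceSum_add [AddCommMonoid W] (x : L) (B : List L) : ∀ φ ψ : List L → W,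
    replaceSum x B (fun C => φ C + ψ C) = replaceSum x B φ + replaceSum x B ψ := by
  induction B with
  | nil => intro φ ψ; simp [replaceSum]
  | cons b B ih => intro φ ψ; simp only [replaceSum]; rw [ih]; abel

theorem replaceSum_sub [AddCommGroup W] (x : L) (B : List L) : ∀ φ ψ : List L → W,
    replaceSum x B (fun C => φ C - ψ C) = replaceSum x B φ - replaceSum x B ψ := by
  induction B with
  | nil => intro φ ψ; simp [replaceSum]
  | cons b B ih => intro φ ψ; simp only [replaceSum]; rw [ih]; abel

theorem replaceSum_map {W' : Type*} [AddCommMonoid W] [AddCommMonoid W'] (f : W →+ W') (x : L)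
    (B : List L) : ∀ φ : List L → W,
    replaceSum x B (fun C => f (φ C)) = f (replaceSum x B φ) := by
  induction B with
  | nil => intro φ; simp [replaceSum]
  | cons b B ih => intro φ; simp only [replaceSum]; rw [ih, map_add]

end Lists

section SymMultilinear

variable (k L W : Type*) [CommRing k] [AddCommGroup L] [Module k L] [AddCommGroup W] [Module k W]

/-- Functions on words that are linear in each letter and symmetric. -/
def SymMultilinear : Submodule k (List L → W) where
  carrier := {φ | (∀ P Q a b, φ (P ++ (a + b) :: Q) = φ (P ++ a :: Q) + φ (P ++ b :: Q)) ∧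
    (∀ P Q (c : k) a, φ (P ++ (c • a) :: Q) = c • φ (P ++ a :: Q)) ∧
    (∀ P Q a b, φ (P ++ a :: b :: Q) = φ (P ++ b :: a :: Q))}
  add_mem' := by
    rintro φ ψ ⟨h1, h2, h3⟩ ⟨g1, g2, g3⟩
    refine ⟨fun P Q a b => ?_, fun P Q c a => ?_, fun P Q a b => ?_⟩
    · simp only [Pi.add_apply, h1, g1]; abel
    · simp only [Pi.add_apply, h2, g2, smul_add]
    · simp only [Pi.add_apply]; rw [h3, g3]
  zero_mem' := by
    refine ⟨fun P Q a b => ?_, fun P Q c a => ?_, fun P Q a b => ?_⟩ <;> simp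
  smul_mem' := by
    rintro r φ ⟨h1, h2, h3⟩
    refine ⟨fun P Q a b => ?_, fun P Q c a => ?_, fun P Q a b => ?_⟩
    · simp only [Pi.smul_apply, h1, smul_add]
    · simp only [Pi.smul_apply, h2]; rw [smul_comm]
    · simp only [Pi.smul_apply]; rw [h3]

variable {k L W}

/-- `φ ↦ φ (x :: ·)`. -/
def prepend : L →ₗ[k] Module.End k (SymMultilinear k L W) where
  toFun x :=
    { toFun := fun φ => ⟨fun B => φ.1 (x :: B),
        fun P Q a b => φ.2.1 (x :: P) Q a b, fun P Q c a => φ.2.2.1 (x :: P) Q c a,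
        fun P Q a b => φ.2.2.2 (x :: P) Q a b⟩
      map_add' := fun _ _ => rfl
      map_smul' := fun _ _ => rfl }
  map_add' x y := by
    refine LinearMap.ext fun φ => Subtype.ext (funext fun B => ?_)
    exact φ.2.1 [] B x y
  map_smul' c x := by
    refine LinearMap.ext fun φ => Subtype.ext (funext fun B => ?_)
    exact φ.2.2.1 [] B c x

/-- The action of `S(L)` on symmetric multilinear functions of words extending `prepend`. -/
def symAct : SymmetricAlgebra k L →ₐ[k] Module.End k (SymMultilinear k L W) :=
  RingCon.liftₐ (TensorAlgebra.symRingCon k L)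
    (TensorAlgebra.lift k (prepend (k := k) (L := L) (W := W))) (by
    refine RingCon.ringConGen_le.2 (fun x y h => ?_)
    induction h with | mul_comm x y
    rw [RingCon.ker_apply]
    refine LinearMap.ext fun φ => Subtype.ext (funext fun B => ?_)
    simp only [AlgHom.toRingHom_eq_coe, RingHom.coe_coe, map_mul, TensorAlgebra.lift_ι_apply]
    exact φ.2.2.2 [] B y x)

theorem symAct_ι (x : L) : symAct (W := W) (SymmetricAlgebra.ι k L x) = prepend x := by
  change TensorAlgebra.lift k (prepend (k := k) (L := L) (W := W)) (TensorAlgebra.ι k x) = _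
  rw [TensorAlgebra.lift_ι_apply]

/-- The linear map `S(L) → W` with `x₁ ⋯ xₙ ↦ φ [x₁, …, xₙ]`. -/
def symLift (φ : SymMultilinear k L W) : SymmetricAlgebra k L →ₗ[k] W where
  toFun A := (symAct A φ).1 []
  map_add' A B := by rw [map_add]; rfl
  map_smul' c A := by rw [map_smul]; rfl

theorem symLift_one (φ : SymMultilinear k L W) : symLift φ 1 = φ.1 [] := by
  simp [symLift]

theorem symLift_ι_mul (φ : SymMultilinear k L W) (x : L) (A : SymmetricAlgebra k L) :
    symLift φ (SymmetricAlgebra.ι k L x * A) = symLift (prepend x φ) A := by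
  simp only [symLift, LinearMap.coe_mk, AddHom.coe_mk]
  rw [mul_comm, map_mul, symAct_ι]
  rfl

theorem symLift_prod (B : List L) : ∀ φ : SymMultilinear k L W,
    symLift φ (B.map (SymmetricAlgebra.ι k L)).prod = φ.1 B := by
  induction B with
  | nil => intro φ; simpa using symLift_one φ
  | cons b B ih => intro φ; rw [List.map_cons, List.prod_cons, symLift_ι_mul, ih]; rfl

/-- Linear maps on `S(L)` are determined on products of elements of `L`. -/
theorem sym_hom_ext {f g : SymmetricAlgebra k L →ₗ[k] W}
    (h : ∀ B : List L, f (B.map (SymmetricAlgebra.ι k L)).prod =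
      g (B.map (SymmetricAlgebra.ι k L)).prod) : f = g := by
  have key : Submodule.span k
      (Set.range fun B : List L => (B.map (SymmetricAlgebra.ι k L)).prod) = ⊤ := by
    have hmul : ∀ a ∈ Submodule.span k
          (Set.range fun B : List L => (B.map (SymmetricAlgebra.ι k L)).prod),
        ∀ b ∈ Submodule.span k
          (Set.range fun B : List L => (B.map (SymmetricAlgebra.ι k L)).prod),
        a * b ∈ Submodule.span k
          (Set.range fun B : List L => (B.map (SymmetricAlgebra.ι k L)).prod) := by
      intro a ha b hb
      have := Submodule.mul_mem_mul ha hb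
      rw [Submodule.span_mul_span] at this
      refine Submodule.span_mono ?_ this
      rintro _ ⟨_, ⟨P, rfl⟩, _, ⟨Q, rfl⟩, rfl⟩
      exact ⟨P ++ Q, by simp⟩
    refine Submodule.eq_top_iff'.2 fun A => ?_
    induction A using SymmetricAlgebra.induction with
    | algebraMap r =>
      rw [Algebra.algebraMap_eq_smul_one]
      exact Submodule.smul_mem _ _ (Submodule.subset_span ⟨[], by simp⟩)
    | ι x => exact Submodule.subset_span ⟨[x], by simp⟩
    | mul a b ha hb => exact hmul a ha b hb
    | add a b ha hb => exact Submodule.add_mem _ ha hb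
  refine LinearMap.ext_on key ?_
  rintro _ ⟨B, rfl⟩
  exact h B

end SymMultilinear

section Brace

variable (k : Type*) {L W : Type*} [CommRing k] [RightPreLieRing L] [RightPreLieAlgebra k L]

theorem replaceSum_add_mid [AddCommGroup W] (x : L) :
    ∀ (P : List L) (φ : List L → W),
      (∀ P Q a b, φ (P ++ (a + b) :: Q) = φ (P ++ a :: Q) + φ (P ++ b :: Q)) →
      ∀ Q a b, replaceSum x (P ++ (a + b) :: Q) φ =
        replaceSum x (P ++ a :: Q) φ + replaceSum x (P ++ b :: Q) φ := by
  intro P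
  induction P with
  | nil =>
    intro φ h Q a b
    simp only [List.nil_append, replaceSum, add_mul]
    have h0 := h []
    simp only [List.nil_append] at h0
    simp only [h0]
    rw [replaceSum_add]; abel
  | cons p P ih =>
    intro φ h Q a b
    simp only [List.cons_append, replaceSum]
    have h1 := h ((p * x) :: P)
    simp only [List.cons_append] at h1
    rw [h1, ih _ (fun P' => h (p :: P'))]; abel

theorem replaceSum_smul [AddCommGroup W] [Module k W] (x : L) (c : k) :
    ∀ (P : List L) (φ : List L → W),
      (∀ P Q (c : k) a, φ (P ++ (c • a) :: Q) = c • φ (P ++ a :: Q)) →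
      ∀ Q a, replaceSum x (P ++ (c • a) :: Q) φ = c • replaceSum x (P ++ a :: Q) φ := by
  intro P
  induction P with
  | nil =>
    intro φ h Q a
    simp only [List.nil_append, replaceSum, smul_mul_assoc]
    have h0 := h []
    simp only [List.nil_append] at h0
    simp only [h0]
    rw [smul_add]
    congr 1
    exact replaceSum_map (DistribSMul.toAddMonoidHom W c) x Q fun C => φ (a :: C)
  | cons p P ih =>
    intro φ h Q a
    simp only [List.cons_append, replaceSum]
    have h1 := h ((p * x) :: P)
    simp only [List.cons_append] at h1
    rw [h1, ih _ (fun P' => h (p :: P')), smul_add]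

theorem replaceSum_swap [AddCommGroup W] (x : L) :
    ∀ (P : List L) (φ : List L → W), (∀ P Q a b, φ (P ++ a :: b :: Q) = φ (P ++ b :: a :: Q)) →
      ∀ Q a b, replaceSum x (P ++ a :: b :: Q) φ = replaceSum x (P ++ b :: a :: Q) φ := by
  intro P
  induction P with
  | nil =>
    intro φ h Q a b
    simp only [List.nil_append, replaceSum]
    have h0 := h []
    simp only [List.nil_append] at h0
    rw [h0 Q (a * x) b, h0 Q a (b * x)]
    simp only [h0 _ a b]
    abel
  | cons p P ih =>
    intro φ h Q a b
    simp only [List.cons_append, replaceSum]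
    have h1 := h ((p * x) :: P)
    simp only [List.cons_append] at h1
    rw [h1, ih _ (fun P' => h (p :: P'))]

/-- The derivations `↶ x`, `↶ y` of words satisfy the commutation relation of `L`. -/
theorem replaceSum_comm [AddCommGroup W] (x y : L) (B : List L) :
    ∀ φ : List L → W, (∀ P Q a b, φ (P ++ (a + b) :: Q) = φ (P ++ a :: Q) + φ (P ++ b :: Q)) →
      replaceSum x B (fun C => replaceSum y C φ) + replaceSum (y * x) B φ =
        replaceSum y B (fun C => replaceSum x C φ) + replaceSum (x * y) B φ := by
  induction B with
  | nil => intro φ _; simp [replaceSum]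
  | cons b B ih =>
    intro φ h
    simp only [replaceSum]
    rw [replaceSum_add, replaceSum_add]
    have h1 := ih (fun C => φ (b :: C)) (fun P' => h (b :: P'))
    have h0 := h [] B
    simp only [List.nil_append] at h0
    have e := RightPreLieRing.assoc_symm b x y
    simp only [associator] at e
    have e' : b * x * y + b * (y * x) = b * y * x + b * (x * y) := by
      have := sub_eq_sub_iff_add_eq_add.1 e
      exact this
    have h2 : φ ((b * x * y) :: B) + φ ((b * (y * x)) :: B) =
        φ ((b * y * x) :: B) + φ ((b * (x * y)) :: B) := by
      rw [← h0, ← h0, e']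
    rw [← sub_eq_zero] at h1 h2 ⊢
    have h3 := congrArg₂ (· + ·) h1 h2
    simp only [add_zero] at h3
    rw [← h3]
    abel

theorem replaceSum_add_left [AddCommGroup W] (x y : L) (B : List L) :
    ∀ φ : List L → W, (∀ P Q a b, φ (P ++ (a + b) :: Q) = φ (P ++ a :: Q) + φ (P ++ b :: Q)) →
      replaceSum (x + y) B φ = replaceSum x B φ + replaceSum y B φ := by
  induction B with
  | nil => intro φ _; simp [replaceSum]
  | cons b B ih =>
    intro φ h
    have h0 := h [] B
    simp only [List.nil_append] at h0
    simp only [replaceSum, mul_add, h0]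
    rw [ih (fun C => φ (b :: C)) (fun P' => h (b :: P'))]
    abel

theorem replaceSum_smul_left [AddCommGroup W] [Module k W] (c : k) (x : L) (B : List L) :
    ∀ φ : List L → W, (∀ P Q (c : k) a, φ (P ++ (c • a) :: Q) = c • φ (P ++ a :: Q)) →
      replaceSum (c • x) B φ = c • replaceSum x B φ := by
  induction B with
  | nil => intro φ _; simp [replaceSum]
  | cons b B ih =>
    intro φ h
    have h0 := h [] B
    simp only [List.nil_append] at h0
    simp only [replaceSum, mul_smul_comm, h0]
    rw [ih (fun C => φ (b :: C)) (fun P' => h (b :: P')), smul_add]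

theorem braceAux_mem (n : ℕ) :
    (braceAux k n : List L → Module.End k L) ∈ SymMultilinear k L (Module.End k L) := by
  induction n using Nat.strong_induction_on with
  | _ n ih =>
  cases n with
  | zero =>
    refine ⟨fun P Q a b => ?_, fun P Q c a => ?_, fun P Q a b => ?_⟩ <;> cases P <;>
      simp [braceAux]
  | succ n =>
    obtain ⟨h1, h2, h3⟩ := ih n (Nat.lt_succ_self n)
    refine ⟨fun P Q a b => ?_, fun P Q c a => ?_, fun P Q a b => ?_⟩
    · cases P with
      | nil =>
        simp only [List.nil_append, braceAux]
        rw [replaceSum_add_left a b Q _ h1]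
        have e : LinearMap.mulRight k (a + b) = LinearMap.mulRight k a + LinearMap.mulRight k b :=
          LinearMap.ext fun l => mul_add l a b
        rw [e, LinearMap.add_comp]
        abel
      | cons p P =>
        simp only [List.cons_append, braceAux]
        rw [replaceSum_add_mid p P _ h1, h1, LinearMap.comp_add]
        abel
    · cases P with
      | nil =>
        simp only [List.nil_append, braceAux]
        rw [replaceSum_smul_left k c a Q _ h2]
        have e : LinearMap.mulRight k (c • a) = c • LinearMap.mulRight k a :=
          LinearMap.ext fun l => mul_smul_comm c l a
        rw [e, LinearMap.smul_comp, smul_sub]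
      | cons p P =>
        simp only [List.cons_append, braceAux]
        rw [replaceSum_smul k p c P _ h2, h2, LinearMap.comp_smul, smul_sub]
    · cases P with
      | nil =>
        cases n with
        | zero =>
          have hz : ∀ (Q : List L) (x : L), replaceSum x Q
              (fun _ => (0 : Module.End k L)) = 0 := by
            intro Q x
            induction Q with
            | nil => rfl
            | cons q Q ih => simp [replaceSum, ih]
          simp [braceAux, replaceSum, hz]
        | succ m =>
          have hm : ∀ (x y : L) (B : List L), braceAux k (m + 2) (x :: y :: B) =
              (LinearMap.mulRight k x ∘ₗ LinearMap.mulRight k y - LinearMap.mulRight k (y * x)) ∘ₗ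
                braceAux k m B - LinearMap.mulRight k x ∘ₗ replaceSum y B (braceAux k m)
              - LinearMap.mulRight k y ∘ₗ replaceSum x B (braceAux k m)
              + (replaceSum x B (fun C => replaceSum y C (braceAux k m))
                + replaceSum (y * x) B (braceAux k m)) := by
            intro x y B
            have e := replaceSum_map
              (LinearMap.toAddMonoidHom (LinearMap.llcomp k L L L (LinearMap.mulRight k y))) x B
              (braceAux k m)
            simp only [LinearMap.toAddMonoidHom_coe, LinearMap.llcomp_apply'] at e
            simp only [braceAux, replaceSum]
            rw [replaceSum_sub, e, LinearMap.comp_sub, LinearMap.sub_comp, LinearMap.comp_assoc]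
            abel
          have e1 : LinearMap.mulRight k a ∘ₗ LinearMap.mulRight k b - LinearMap.mulRight k (b * a) =
              LinearMap.mulRight k b ∘ₗ LinearMap.mulRight k a
                - LinearMap.mulRight k (a * b) := by
            refine LinearMap.ext fun l => ?_
            have e := RightPreLieRing.assoc_symm l b a
            simp only [associator] at e
            exact e
          have e2 := replaceSum_comm a b Q _ (ih m (by omega)).1
          rw [List.nil_append, List.nil_append, hm, hm, e1, e2]
          abel
      | cons p P =>
        simp only [List.cons_append, braceAux]
        rw [replaceSum_swap p P _ h3, h3]

theorem braceList_mem :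
    (braceList k : List L → Module.End k L) ∈ SymMultilinear k L (Module.End k L) := by
  refine ⟨fun P Q a b => ?_, fun P Q c a => ?_, fun P Q a b => ?_⟩
  · have h := (braceAux_mem k (P ++ a :: Q).length).1 P Q a b
    rwa [braceAux_eq, braceAux_eq, braceAux_eq] at h <;> simp
  · have h := (braceAux_mem k (P ++ a :: Q).length).2.1 P Q c a
    rwa [braceAux_eq, braceAux_eq] at h <;> simp
  · have h := (braceAux_mem k (P ++ a :: b :: Q).length).2.2 P Q a b
    rwa [braceAux_eq, braceAux_eq] at h <;> simp

/-- The symmetric brace `l ↶ B` of `l ∈ L` and `B ∈ S(L)`, as `brace k B l`. It is characterised by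
`l ↶ 1 = l` and `l ↶ (x B) = (l ↶ B) ↶ x - l ↶ (B ↶ x)` for `x ∈ L`, where `· ↶ x` is the
derivation of `S(L)` extending `l ↦ l * x`: see `brace_one` and `brace_ι_mul`. -/
def brace : SymmetricAlgebra k L →ₗ[k] Module.End k L := symLift ⟨braceList k, braceList_mem k⟩

theorem brace_prod (B : List L) :
    brace k (B.map (SymmetricAlgebra.ι k L)).prod = braceList k B := symLift_prod B _

/-- `l ↶ 1 = l`. -/
theorem brace_one (l : L) : brace k 1 l = l := by
  have h := brace_prod k ([] : List L)
  rw [List.map_nil, List.prod_nil] at h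
  rw [h]; rfl

/-- `l ↦ (B ↦ l ↶ B)`, with values in the linear maps from `S(L)` to `L ⊆ S(L)`. -/
def braceHom : L →ₗ[k] WithConv (SymmetricAlgebra k L →ₗ[k] SymmetricAlgebra k L) where
  toFun l := WithConv.toConv (SymmetricAlgebra.ι k L ∘ₗ LinearMap.applyₗ l ∘ₗ brace k)
  map_add' l l' := by
    refine WithConv.ext (LinearMap.ext fun B => ?_)
    simp
  map_smul' c l := by
    refine WithConv.ext (LinearMap.ext fun B => ?_)
    simp

/-- The extension `A ↶ B` of the brace to `A, B ∈ S(L)`, as `act k A B`: it is multiplicative in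
`A`, in the sense that `A A' ↶ B = (A ↶ B₁) (A' ↶ B₂)` and `1 ↶ B = ε(B)`, where
`Δ B = B₁ ⊗ B₂` is the coproduct of `S(L)` for which the elements of `L` are primitive. That is,
`act k` is an algebra morphism from `S(L)` to the convolution algebra of `S(L)`. -/
def act : SymmetricAlgebra k L →ₐ[k]
    WithConv (SymmetricAlgebra k L →ₗ[k] SymmetricAlgebra k L) :=
  SymmetricAlgebra.lift (braceHom k)

/-- The Guin–Oudom product `A ∗ B = (A ↶ B₁) B₂` on `S(L)`, i.e. the convolution product of
`A ↶ ·` and the identity. On monomials it reads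
`(t₁ ⋯ tₙ) ∗ (t'₁ ⋯ t'ₘ) = ∑ F₀ (t₁ ↶ F₁) ⋯ (tₙ ↶ Fₙ)`, the sum being over all maps
`f : {1, …, m} → {0, …, n}`, with `Fᵢ` the product of the `t'ⱼ` such that `f j = i`. -/
def starMul (A B : SymmetricAlgebra k L) : SymmetricAlgebra k L :=
  (act k A * WithConv.toConv LinearMap.id).ofConv B

/-- The derivation `A ↦ A ↶ x` of `S(L)`, for `x ∈ L`. -/
def rightAct (x : L) : SymmetricAlgebra k L →ₗ[k] SymmetricAlgebra k L :=
  LinearMap.applyₗ (SymmetricAlgebra.ι k L x) ∘ₗ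
    (WithConv.linearEquiv k _).toLinearMap ∘ₗ (act k).toLinearMap

theorem rightAct_apply (x : L) (A : SymmetricAlgebra k L) :
    rightAct k x A = act k A (SymmetricAlgebra.ι k L x) := rfl

theorem act_ι (l : L) (B : SymmetricAlgebra k L) :
    act k (SymmetricAlgebra.ι k L l) B = SymmetricAlgebra.ι k L (brace k B l) := by
  rw [act, SymmetricAlgebra.lift_ι_apply]; rfl

theorem act_algebraMap (r : k) (B : SymmetricAlgebra k L) :
    act k (algebraMap k _ r) B = r • algebraMap k _ (Coalgebra.counit (R := k) B) := by
  rw [AlgHom.commutes]; rfl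

theorem act_mul (A A' B : SymmetricAlgebra k L) :
    act k (A * A') B = LinearMap.mul' k _
      (TensorProduct.map (act k A).ofConv (act k A').ofConv (Coalgebra.comul (R := k) B)) := by
  rw [map_mul]; rfl

theorem act_add (A A' B : SymmetricAlgebra k L) :
    act k (A + A') B = act k A B + act k A' B := by
  rw [map_add]; rfl

theorem act_one (A : SymmetricAlgebra k L) : act k A 1 = A := by
  induction A using SymmetricAlgebra.induction with
  | algebraMap r => rw [act_algebraMap]; simp [Algebra.algebraMap_eq_smul_one]
  | ι x => rw [act_ι, brace_one]
  | mul a b ha hb =>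
    rw [act_mul, Bialgebra.comul_one, Algebra.TensorProduct.one_def, TensorProduct.map_tmul,
      LinearMap.mul'_apply, ha, hb]
  | add a b ha hb => rw [act_add, ha, hb]

theorem rightAct_ι (x l : L) :
    rightAct k x (SymmetricAlgebra.ι k L l) = SymmetricAlgebra.ι k L (l * x) := by
  have h := brace_prod k [x]
  rw [List.map_singleton, List.prod_singleton] at h
  rw [rightAct_apply, act_ι, h, braceList_cons, braceList_nil]
  simp [replaceSum]

theorem rightAct_algebraMap (x : L) (r : k) :
    rightAct k x (algebraMap k (SymmetricAlgebra k L) r) = 0 := by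
  rw [rightAct_apply, act_algebraMap]; simp

theorem rightAct_mul (x : L) (A B : SymmetricAlgebra k L) :
    rightAct k x (A * B) = rightAct k x A * B + A * rightAct k x B := by
  simp only [rightAct_apply]
  rw [act_mul, SymmetricAlgebra.comul_ι, map_add, map_add, TensorProduct.map_tmul,
    TensorProduct.map_tmul, LinearMap.mul'_apply, LinearMap.mul'_apply, act_one, act_one]

theorem symLift_rightAct [AddCommGroup W] [Module k W] (x : L) (B : List L) :
    ∀ φ : SymMultilinear k L W,
      symLift φ (rightAct k x (B.map (SymmetricAlgebra.ι k L)).prod) = replaceSum x B φ.1 := by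
  induction B with
  | nil =>
    intro φ
    rw [List.map_nil, List.prod_nil, ← map_one (algebraMap k (SymmetricAlgebra k L)),
      rightAct_algebraMap, map_zero]
    rfl
  | cons b B ih =>
    intro φ
    rw [List.map_cons, List.prod_cons, rightAct_mul, rightAct_ι, map_add, symLift_ι_mul,
      symLift_ι_mul, ih, symLift_prod]
    rfl

/-- `l ↶ (x B) = (l ↶ B) ↶ x - l ↶ (B ↶ x)`. -/
theorem brace_ι_mul (x l : L) (B : SymmetricAlgebra k L) :
    brace k (SymmetricAlgebra.ι k L x * B) l =
      brace k B l * x - brace k (rightAct k x B) l := by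
  have h : brace k ∘ₗ LinearMap.mulLeft k (SymmetricAlgebra.ι k L x) =
      (LinearMap.llcomp k L L L (LinearMap.mulRight k x)) ∘ₗ brace k
        - brace k ∘ₗ rightAct k x := by
    refine sym_hom_ext fun C => ?_
    simp only [LinearMap.comp_apply, LinearMap.sub_apply, LinearMap.mulLeft_apply,
      LinearMap.llcomp_apply']
    rw [← List.prod_cons, ← List.map_cons, brace_prod, brace_prod, braceList_cons]
    congr 1
    exact (symLift_rightAct k x C ⟨braceList k, braceList_mem k⟩).symm
  exact congrArg (fun f => f B l) h

theorem counit_rightAct (x : L) (A : SymmetricAlgebra k L) :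
    Coalgebra.counit (R := k) (rightAct k x A) = 0 := by
  induction A using SymmetricAlgebra.induction with
  | algebraMap r => rw [rightAct_algebraMap, map_zero]
  | ι x => rw [rightAct_ι, SymmetricAlgebra.counit_ι]
  | mul a b ha hb => rw [rightAct_mul]; simp [ha, hb]
  | add a b ha hb => rw [map_add, map_add, ha, hb, add_zero]

open TensorProduct in
theorem comul_rightAct (x : L) (A : SymmetricAlgebra k L) :
    Coalgebra.comul (R := k) (rightAct k x A) =
      TensorProduct.map (rightAct k x) LinearMap.id (Coalgebra.comul (R := k) A) +
      TensorProduct.map LinearMap.id (rightAct k x) (Coalgebra.comul (R := k) A) := by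
  have h0 : rightAct k x (1 : SymmetricAlgebra k L) = 0 := by
    rw [← map_one (algebraMap k (SymmetricAlgebra k L)), rightAct_algebraMap]
  have h1 : ∀ u v : SymmetricAlgebra k L ⊗[k] SymmetricAlgebra k L,
      TensorProduct.map (rightAct k x) LinearMap.id (u * v) =
        TensorProduct.map (rightAct k x) LinearMap.id u * v +
          u * TensorProduct.map (rightAct k x) LinearMap.id v := by
    intro u v
    induction u with
    | zero => simp
    | add a b ha hb => simp only [add_mul, map_add, ha, hb]; abel
    | tmul a b =>
      induction v with
      | zero => simp
      | add c d hc hd => simp only [mul_add, map_add, hc, hd]; abel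
      | tmul c d => simp [rightAct_mul, TensorProduct.add_tmul]
  have h2 : ∀ u v : SymmetricAlgebra k L ⊗[k] SymmetricAlgebra k L,
      TensorProduct.map LinearMap.id (rightAct k x) (u * v) =
        TensorProduct.map LinearMap.id (rightAct k x) u * v +
          u * TensorProduct.map LinearMap.id (rightAct k x) v := by
    intro u v
    induction u with
    | zero => simp
    | add a b ha hb => simp only [add_mul, map_add, ha, hb]; abel
    | tmul a b =>
      induction v with
      | zero => simp
      | add c d hc hd => simp only [mul_add, map_add, hc, hd]; abel
      | tmul c d => simp [rightAct_mul, TensorProduct.tmul_add]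
  induction A using SymmetricAlgebra.induction with
  | algebraMap r =>
    rw [rightAct_algebraMap, map_zero, Bialgebra.comul_algebraMap,
      Algebra.TensorProduct.algebraMap_apply]
    simp [h0, rightAct_algebraMap]
  | ι y => rw [rightAct_ι]; simp [h0, rightAct_ι]
  | mul a b ha hb =>
    rw [rightAct_mul, map_add, Bialgebra.comul_mul, Bialgebra.comul_mul, Bialgebra.comul_mul,
      ha, hb, h1, h2]
    ring
  | add a b ha hb => simp only [map_add, ha, hb]; abel

open TensorProduct in
/-- Precomposition with `B ↦ B x + B ↶ x` is a derivation of the convolution algebra. -/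
theorem conv_apply_step (x : L) (f g : SymmetricAlgebra k L →ₗ[k] SymmetricAlgebra k L)
    (B : SymmetricAlgebra k L) :
    LinearMap.mul' k _ (TensorProduct.map f g (Coalgebra.comul (R := k)
        (B * SymmetricAlgebra.ι k L x + rightAct k x B))) =
      LinearMap.mul' k _ (TensorProduct.map
        (f ∘ₗ (LinearMap.mulRight k (SymmetricAlgebra.ι k L x) + rightAct k x)) g
        (Coalgebra.comul (R := k) B)) +
      LinearMap.mul' k _ (TensorProduct.map f
        (g ∘ₗ (LinearMap.mulRight k (SymmetricAlgebra.ι k L x) + rightAct k x))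
        (Coalgebra.comul (R := k) B)) := by
  rw [map_add, Bialgebra.comul_mul, SymmetricAlgebra.comul_ι, comul_rightAct]
  generalize Coalgebra.comul (R := k) B = t
  induction t with
  | zero => simp
  | add a b ha hb =>
    simp only [add_mul, map_add] at ha hb ⊢
    linear_combination ha + hb
  | tmul a b =>
    simp only [mul_add, Algebra.TensorProduct.tmul_mul_tmul, mul_one, TensorProduct.map_tmul,
      map_add, LinearMap.mul'_apply, LinearMap.comp_apply, LinearMap.add_apply,
      LinearMap.mulRight_apply, LinearMap.id_apply]
    ring

open TensorProduct in
theorem rightAct_conv (x : L) (f g : SymmetricAlgebra k L →ₗ[k] SymmetricAlgebra k L)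
    (t : SymmetricAlgebra k L ⊗[k] SymmetricAlgebra k L) :
    rightAct k x (LinearMap.mul' k _ (TensorProduct.map f g t)) =
      LinearMap.mul' k _ (TensorProduct.map (rightAct k x ∘ₗ f) g t) +
      LinearMap.mul' k _ (TensorProduct.map f (rightAct k x ∘ₗ g) t) := by
  induction t with
  | zero => simp
  | add a b ha hb => simp only [map_add, ha, hb]; abel
  | tmul a b => simp [rightAct_mul]

/-- `A ↶ (B ∗ x) = (A ↶ B) ↶ x`. -/
theorem act_step (x : L) (A : SymmetricAlgebra k L) : ∀ B,
    act k A (B * SymmetricAlgebra.ι k L x + rightAct k x B) = rightAct k x (act k A B) := by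
  induction A using SymmetricAlgebra.induction with
  | algebraMap r =>
    intro B
    rw [act_algebraMap, act_algebraMap, map_smul, rightAct_algebraMap]
    simp [counit_rightAct]
  | ι l =>
    intro B
    rw [act_ι, act_ι, rightAct_ι, map_add, mul_comm, LinearMap.add_apply, brace_ι_mul,
      sub_add_cancel]
  | mul a b ha hb =>
    intro B
    have ha' : (act k a).ofConv ∘ₗ (LinearMap.mulRight k (SymmetricAlgebra.ι k L x)
        + rightAct k x) = rightAct k x ∘ₗ (act k a).ofConv := LinearMap.ext ha
    have hb' : (act k b).ofConv ∘ₗ (LinearMap.mulRight k (SymmetricAlgebra.ι k L x)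
        + rightAct k x) = rightAct k x ∘ₗ (act k b).ofConv := LinearMap.ext hb
    rw [act_mul, act_mul, conv_apply_step, ha', hb', rightAct_conv]
  | add a b ha hb => intro B; rw [act_add, act_add, ha, hb, map_add (rightAct k x)]

theorem starMul_eq (A B : SymmetricAlgebra k L) :
    starMul k A B = LinearMap.mul' k _
      (TensorProduct.map (act k A).ofConv LinearMap.id (Coalgebra.comul (R := k) B)) := rfl

theorem starMul_add (A B C : SymmetricAlgebra k L) :
    starMul k A (B + C) = starMul k A B + starMul k A C := map_add _ _ _

theorem starMul_smul (c : k) (A B : SymmetricAlgebra k L) :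
    starMul k A (c • B) = c • starMul k A B := map_smul _ _ _

theorem starMul_add_left (A B C : SymmetricAlgebra k L) :
    starMul k (A + B) C = starMul k A C + starMul k B C := by
  simp only [starMul, map_add, add_mul]; rfl

theorem starMul_smul_left (c : k) (A B : SymmetricAlgebra k L) :
    starMul k (c • A) B = c • starMul k A B := by
  simp only [starMul, map_smul, smul_mul_assoc]; rfl

/-- The unit of `∗`. -/
theorem one_starMul (A : SymmetricAlgebra k L) : starMul k 1 A = A := by
  rw [starMul, map_one, one_mul]; rfl

theorem starMul_one (A : SymmetricAlgebra k L) : starMul k A 1 = A := by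
  rw [starMul_eq, Bialgebra.comul_one, Algebra.TensorProduct.one_def, TensorProduct.map_tmul,
    LinearMap.mul'_apply, act_one, LinearMap.id_apply, mul_one]

/-- `A ∗ x = A x + A ↶ x`. -/
theorem starMul_ι (A : SymmetricAlgebra k L) (x : L) :
    starMul k A (SymmetricAlgebra.ι k L x) =
      A * SymmetricAlgebra.ι k L x + rightAct k x A := by
  rw [starMul_eq, SymmetricAlgebra.comul_ι, map_add, map_add, TensorProduct.map_tmul,
    TensorProduct.map_tmul, LinearMap.mul'_apply, LinearMap.mul'_apply, act_one, rightAct_apply,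
    LinearMap.id_apply, LinearMap.id_apply, mul_one, add_comm]

theorem starMul_assoc_ι (A B : SymmetricAlgebra k L) (x : L) :
    starMul k (starMul k A B) (SymmetricAlgebra.ι k L x) =
      starMul k A (starMul k B (SymmetricAlgebra.ι k L x)) := by
  have h : (act k A).ofConv ∘ₗ (LinearMap.mulRight k (SymmetricAlgebra.ι k L x)
      + rightAct k x) = rightAct k x ∘ₗ (act k A).ofConv := LinearMap.ext (act_step k x A)
  rw [starMul_ι, starMul_ι, starMul_eq, starMul_eq, conv_apply_step, h, rightAct_conv,
    LinearMap.id_comp, LinearMap.comp_id, TensorProduct.map_add_right, LinearMap.add_apply,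
    map_add]
  have h2 : ∀ t, LinearMap.mul' k _ (TensorProduct.map (act k A).ofConv
      (LinearMap.mulRight k (SymmetricAlgebra.ι k L x)) t) = LinearMap.mul' k _
      (TensorProduct.map (act k A).ofConv LinearMap.id t) * SymmetricAlgebra.ι k L x := by
    intro t
    induction t with
    | zero => simp
    | add a b ha hb => simp only [map_add, ha, hb, add_mul]
    | tmul a b => simp [mul_assoc]
  rw [h2]
  abel

/-- `∗` is associative. -/
theorem starMul_assoc (A B C : SymmetricAlgebra k L) :
    starMul k (starMul k A B) C = starMul k A (starMul k B C) := by
  have hr : ∀ (x : L) (P : List L) (h : SymmetricAlgebra k L →ₗ[k] SymmetricAlgebra k L),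
      h (rightAct k x (P.map (SymmetricAlgebra.ι k L)).prod) =
        replaceSum x P (fun Q => h (Q.map (SymmetricAlgebra.ι k L)).prod) := by
    intro x P
    induction P with
    | nil =>
      intro h
      rw [List.map_nil, List.prod_nil, ← map_one (algebraMap k (SymmetricAlgebra k L)),
        rightAct_algebraMap, map_zero]
      rfl
    | cons b P ih =>
      intro h
      rw [List.map_cons, List.prod_cons, rightAct_mul, rightAct_ι, map_add]
      have := ih (h ∘ₗ LinearMap.mulLeft k (SymmetricAlgebra.ι k L b))
      simp only [LinearMap.comp_apply, LinearMap.mulLeft_apply] at this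
      rw [this]
      simp only [replaceSum, List.map_cons, List.prod_cons]
  let sm : SymmetricAlgebra k L → SymmetricAlgebra k L →ₗ[k] SymmetricAlgebra k L :=
    fun A => (act k A * WithConv.toConv LinearMap.id).ofConv
  have hsm : ∀ A B, starMul k A B = sm A B := fun _ _ => rfl
  have key : ∀ (n : ℕ) (P : List L), P.length = n →
      sm (sm A B) (P.map (SymmetricAlgebra.ι k L)).prod =
        (sm A ∘ₗ sm B) (P.map (SymmetricAlgebra.ι k L)).prod := by
    intro n
    induction n with
    | zero =>
      intro P hP
      obtain rfl := List.length_eq_zero_iff.1 hP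
      simp only [List.map_nil, List.prod_nil, LinearMap.comp_apply, ← hsm, starMul_one]
    | succ n ih =>
      intro P hP
      cases P with
      | nil => simp at hP
      | cons x P =>
        have hP' : P.length = n := by simpa using hP
        have e : (List.map (SymmetricAlgebra.ι k L) (x :: P)).prod =
            starMul k (P.map (SymmetricAlgebra.ι k L)).prod (SymmetricAlgebra.ι k L x)
              - rightAct k x (P.map (SymmetricAlgebra.ι k L)).prod := by
          rw [starMul_ι, List.map_cons, List.prod_cons, add_sub_cancel_right, mul_comm]
        rw [e, map_sub, map_sub, hr, hr,
          replaceSum_congr x P _ _ (fun Q hQ => ih Q (hQ.trans hP'))]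
        congr 1
        have ihP := ih P hP'
        simp only [LinearMap.comp_apply, ← hsm] at ihP ⊢
        rw [← starMul_assoc_ι, ihP, starMul_assoc_ι, starMul_assoc_ι]
  have := sym_hom_ext (f := sm (sm A B)) (g := sm A ∘ₗ sm B) fun P => key _ P rfl
  exact congrArg (fun f => f C) this

/-- The iterated product `A₁ ∗ ⋯ ∗ Aₘ`, equal to `1` for the empty list. -/
def starProd (As : List (SymmetricAlgebra k L)) : SymmetricAlgebra k L :=
  As.foldl (starMul k) 1

end Brace

section Blocks

variable {L : Type*} [RightPreLieRing L]

/-- For a family `v` indexed by `{1, …, h}` with `h ≥ 1`, the element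
`∑_{σ ∈ S_{h-1}} v_{σ(1)} ↶ (v_{σ(2)} ↶ (⋯ ↶ (v_{σ(h-1)} ↶ v_h) ⋯))`. -/
def blockElt : (h : ℕ) → (Fin h → L) → L
  | 0, _ => 0
  | h + 1, v => ∑ σ : Equiv.Perm (Fin h),
      (List.ofFn fun i => v (σ i).castSucc).foldr (fun a b => a * b) (v (Fin.last h))

end Blocks

end PreLie

end

/-! The argument is an induction that removes the block containing the largest index. Write
$N(S,x)=\sum_\sigma s_{\sigma(1)}\curvearrowleft(\cdots\curvearrowleft(s_{\sigma(h)}\curvearrowleft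
x)\cdots)$, so that $l_P=N(S,x)$ when $x$ is the last letter of $P$ and $S$ holds the others. The
central identity (`splitSum_starMul_nestSum`) is $$l_1\cdots l_m\,x=\sum_{S\sqcup
R=[m]}(-1)^{|S|}\,l_R\ast N(S,x),$$ where, in this display only, $l_R$ is the commutative product
over $R$.

It telescopes. Since $A\ast y=Ay+A\curvearrowleft y$ and $\curvearrowleft y$ is a derivation, each
summand is $l_R N(S,x)$ plus the sum over $j\in R$ of $l_{R\setminus j}\,(l_j\curvearrowleft
N(S,x))$. Moving $j$ into $S$ and summing over the choice of outermost letter rebuilds $N$ on the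
larger set with the opposite sign. Only $S=\emptyset$ survives.

Applying the induction hypothesis to $l_R$ and appending $N(S,x)$ as last factor gives the sum over
partitions, since the block with the largest index comes last (`partSum_append_singleton`). Sums
over words stand in for sums over subsets and partitions; `sum_orderedFinpartition` and
`nestSum_ofFn` translate back. -/

namespace PreLie

/-! ### Sums over letters, splittings and partitions of a word -/

section ListSums

variable {L M N : Type*} [AddCommMonoid M] [AddCommMonoid N]

/-- `∑ⱼ ψ lⱼ (l without its j-th entry)`. -/
def pickSum : List L → (L → List L → M) → M
  | [], _ => 0
  | a :: l, ψ => ψ a l + pickSum l (fun j l' => ψ j (a :: l'))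

/-- The sum of `ψ S R` over all ways to split a word into a subword `S` and its complement `R`. -/
def splitSum : List L → (List L → List L → M) → M
  | [], ψ => ψ [] []
  | a :: l, ψ => splitSum l (fun S R => ψ (a :: S) R + ψ S (a :: R))

/-- The sum of `φ` over all ways to prepend the letter `a` to one of the words in a list. -/
def insertSum (a : L) : List (List L) → (List (List L) → M) → M
  | [], _ => 0
  | B :: Bs, φ => φ ((a :: B) :: Bs) + insertSum a Bs (fun Cs => φ (B :: Cs))

/-- The sum of `φ` over all partitions of a word into nonempty subwords, ordered by the position of
their last letters. -/
def partSum : List L → (List (List L) → M) → M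
  | [], φ => φ []
  | a :: l, φ => partSum l (fun Bs => φ ([a] :: Bs) + insertSum a Bs φ)

theorem pickSum_congr (l : List L) : ∀ ψ χ : L → List L → M,
    (∀ j l', l'.length + 1 = l.length → ψ j l' = χ j l') → pickSum l ψ = pickSum l χ := by
  induction l with
  | nil => intro ψ χ _; rfl
  | cons a l ih =>
    intro ψ χ h
    rw [pickSum, pickSum, h a l rfl, ih _ _ fun j l' h' => h j (a :: l') (by simp [h'])]

theorem pickSum_map (f : M →+ N) (l : List L) : ∀ ψ : L → List L → M,
    pickSum l (fun j l' => f (ψ j l')) = f (pickSum l ψ) := by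
  induction l with
  | nil => intro ψ; simp [pickSum]
  | cons a l ih => intro ψ; simp only [pickSum]; rw [ih, map_add]

theorem pickSum_ofFn {n : ℕ} (v : Fin (n + 1) → L) (ψ : L → List L → M) :
    pickSum (List.ofFn v) ψ = ∑ j, ψ (v j) (List.ofFn fun i => v (j.succAbove i)) := by
  induction n generalizing ψ with
  | zero => simp [pickSum]
  | succ n ih =>
    rw [List.ofFn_succ, pickSum, Fin.sum_univ_succ, ih]
    congr 1
    refine Finset.sum_congr rfl fun j _ => ?_
    rw [List.ofFn_succ (f := fun i => v (j.succ.succAbove i))]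
    simp

theorem splitSum_congr (l : List L) : ∀ ψ χ : List L → List L → M,
    (∀ S R, S.length + R.length = l.length → ψ S R = χ S R) → splitSum l ψ = splitSum l χ := by
  induction l with
  | nil => intro ψ χ h; exact h _ _ rfl
  | cons a l ih =>
    intro ψ χ h
    refine ih _ _ fun S R hSR => ?_
    rw [h, h] <;> simp only [List.length_cons] <;> omega

theorem splitSum_add (l : List L) : ∀ ψ χ : List L → List L → M,
    splitSum l (fun S R => ψ S R + χ S R) = splitSum l ψ + splitSum l χ := by
  induction l with
  | nil => intro ψ χ; rfl
  | cons a l ih =>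
    intro ψ χ
    simp only [splitSum]
    rw [← ih]
    refine splitSum_congr _ _ _ fun S R _ => ?_
    exact add_add_add_comm _ _ _ _

/-- Only the splitting with empty `S` contributes. This presents a single term as a sum over
splittings, so that a telescoping sum can be compared with it termwise. -/
theorem splitSum_ite (l : List L) : ∀ g : List L → M,
    splitSum l (fun S R => if S.isEmpty then g R else 0) = g l := by
  induction l with
  | nil => intro g; rfl
  | cons a l ih =>
    intro g
    simp only [splitSum, List.isEmpty_cons, Bool.false_eq_true, if_false, zero_add]
    exact ih fun R => g (a :: R)

/-- Moving one letter from the complement `R` to the subword `S`. -/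
theorem splitSum_pickSum_comm (l : List L) : ∀ θ : L → List L → List L → M,
    splitSum l (fun S R => pickSum R fun j R' => θ j S R') =
      splitSum l (fun S R => pickSum S fun j S' => θ j S' R) := by
  induction l with
  | nil => intro θ; rfl
  | cons a l ih =>
    intro θ
    simp only [splitSum, pickSum]
    -- If the moved letter is `a`, both sides contribute `θ a S R`. Otherwise `a` stays on its side
    -- of the splitting and the induction hypothesis applies with `a` absorbed into `θ`.
    rw [splitSum_add, splitSum_add, splitSum_add, splitSum_add, ih fun j S R => θ j (a :: S) R,
      ih fun j S R => θ j S (a :: R)]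
    abel

theorem insertSum_append (a : L) (Bs : List (List L)) (B : List L) :
    ∀ φ : List (List L) → M, insertSum a (Bs ++ [B]) φ =
      insertSum a Bs (fun Cs => φ (Cs ++ [B])) + φ (Bs ++ [a :: B]) := by
  induction Bs with
  | nil => intro φ; simp [insertSum]
  | cons C Bs ih => intro φ; simp only [List.cons_append, insertSum]; rw [ih, add_assoc]

theorem insertSum_map (f : M →+ N) (a : L) (Bs : List (List L)) : ∀ φ : List (List L) → M,
    insertSum a Bs (fun Cs => f (φ Cs)) = f (insertSum a Bs φ) := by
  induction Bs with
  | nil => intro φ; simp [insertSum]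
  | cons B Bs ih => intro φ; simp only [insertSum]; rw [ih, map_add]

theorem insertSum_ofFn (a : L) {m : ℕ} (b : Fin m → List L) : ∀ φ : List (List L) → M,
    insertSum a (List.ofFn b) φ =
      ∑ i, φ (List.ofFn (Function.update b i (a :: b i))) := by
  induction m with
  | zero => intro φ; simp [insertSum]
  | succ m ih =>
    intro φ
    rw [List.ofFn_succ, insertSum, ih, Fin.sum_univ_succ]
    congr 1
    · congr 1
      rw [List.ofFn_succ, Function.update_self]
      simp
    · refine Finset.sum_congr rfl fun i _ => ?_
      congr 1
      rw [List.ofFn_succ, Function.update_of_ne (Fin.succ_ne_zero i).symm]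
      congr 2
      funext j
      by_cases h : j = i
      · subst h; simp
      · rw [Function.update_of_ne h, Function.update_of_ne (by simpa using h)]

theorem partSum_add (l : List L) : ∀ φ χ : List (List L) → M,
    partSum l (fun Bs => φ Bs + χ Bs) = partSum l φ + partSum l χ := by
  have hi : ∀ (a : L) (Bs : List (List L)) (φ χ : List (List L) → M),
      insertSum a Bs (fun Bs => φ Bs + χ Bs) = insertSum a Bs φ + insertSum a Bs χ := by
    intro a Bs
    induction Bs with
    | nil => intro φ χ; simp [insertSum]
    | cons B Bs ih => intro φ χ; simp only [insertSum]; rw [ih]; abel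
  induction l with
  | nil => intro φ χ; rfl
  | cons a l ih =>
    intro φ χ
    simp only [partSum, hi]
    rw [← ih]
    congr 1
    funext Bs
    abel

theorem partSum_map (f : M →+ N) (l : List L) : ∀ φ : List (List L) → M,
    partSum l (fun Bs => f (φ Bs)) = f (partSum l φ) := by
  induction l with
  | nil => intro φ; rfl
  | cons a l ih =>
    intro φ
    simp only [partSum, insertSum_map, ← map_add]
    exact ih _

/-- Splitting off the last block of a partition. -/
theorem partSum_append_singleton (l : List L) (x : L) : ∀ φ : List (List L) → M,
    partSum (l ++ [x]) φ =
      splitSum l (fun S R => partSum R fun Bs => φ (Bs ++ [S ++ [x]])) := by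
  induction l with
  | nil => intro φ; simp [partSum, splitSum, insertSum]
  | cons a l ih =>
    intro φ
    rw [List.cons_append, partSum, ih, splitSum]
    refine splitSum_congr _ _ _ fun S R _ => ?_
    rw [partSum, ← partSum_add]
    congr 1
    funext Bs
    -- The letter `a` forms a singleton or joins a block of `Bs`, which puts it in `R`, or it joins
    -- the last block, which puts it in `S`.
    rw [insertSum_append, List.cons_append, List.cons_append]
    abel

/-! ### Comparison with `OrderedFinpartition` -/

theorem ofFn_cast {p q : ℕ} (h : p = q) (f : Fin p → L) (g : Fin q → L)
    (hfg : ∀ j, f j = g (j.cast h)) : List.ofFn f = List.ofFn g := by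
  subst h
  exact congrArg List.ofFn (funext hfg)

theorem ofFn_extendLeft {n : ℕ} (c : OrderedFinpartition n) (l : Fin (n + 1) → L) :
    (List.ofFn fun i => List.ofFn fun j => l (c.extendLeft.emb i j)) =
      [l 0] :: List.ofFn fun i => List.ofFn fun j => l (c.emb i j).succ :=
  List.ofFn_succ (n := c.length)

theorem ofFn_extendMiddle {n : ℕ} (c : OrderedFinpartition n) (i : Fin c.length)
    (l : Fin (n + 1) → L) :
    (List.ofFn fun m => List.ofFn fun j => l ((c.extendMiddle i).emb m j)) =
      List.ofFn (Function.update (fun m => List.ofFn fun j => l (c.emb m j).succ) i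
        (l 0 :: List.ofFn fun j => l (c.emb i j).succ)) := by
  suffices key : ∀ m : Fin c.length,
      List.ofFn (fun j : Fin ((c.extendMiddle i).partSize m) => l ((c.extendMiddle i).emb m j)) =
        Function.update (fun m => List.ofFn fun j => l (c.emb m j).succ) i
          (l 0 :: List.ofFn fun j => l (c.emb i j).succ) m from
    congrArg (List.ofFn (n := c.length)) (funext key)
  intro m
  rcases eq_or_ne m i with rfl | h
  · rw [Function.update_self]
    -- The block sizes of `extendMiddle` agree with the expected ones only propositionally, so the
    -- enumerations are compared through `Fin.cast`.
    have e : (c.extendMiddle m).partSize m = c.partSize m + 1 := by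
      simp [OrderedFinpartition.extendMiddle]
    refine (ofFn_cast e _ (Fin.cases (l 0) fun j => l (c.emb m j).succ) fun j => ?_).trans ?_
    · have : (c.extendMiddle m).emb m j =
          Fin.cases (motive := fun _ => Fin (n + 1)) 0 (Fin.succ ∘ c.emb m) (j.cast e) := by
        simp only [OrderedFinpartition.extendMiddle, ↓reduceDIte]
        rfl
      rw [this]
      cases j.cast e using Fin.cases <;> rfl
    · rw [List.ofFn_succ]
      rfl
  · rw [Function.update_of_ne h]
    have e : (c.extendMiddle i).partSize m = c.partSize m := by
      simp [OrderedFinpartition.extendMiddle, h]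
    refine ofFn_cast e _ _ fun j => ?_
    simp only [OrderedFinpartition.extendMiddle, h, ↓reduceDIte]
    rfl

/-- By `OrderedFinpartition.extendEquiv`, a partition of `n + 1` points comes from one of `n` points
by adjoining a new smallest element, either as a singleton or in an existing block. The singleton
comes first and no other maximum changes its rank, so the order of blocks is kept. This is the
recursion of `partSum`, which is why the latter consumes words from the left. -/
theorem sum_orderedFinpartition {n : ℕ} (l : Fin n → L) (φ : List (List L) → M) :
    ∑ P : OrderedFinpartition n,
        φ (List.ofFn fun i => List.ofFn fun j => l (P.emb i j)) =
      partSum (List.ofFn l) φ := by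
  induction n generalizing φ with
  | zero =>
    rw [Fintype.sum_unique]
    rfl
  | succ n ih =>
    rw [← (OrderedFinpartition.extendEquiv n).sum_comp, Fintype.sum_sigma, List.ofFn_succ, partSum,
      ← ih]
    refine Finset.sum_congr rfl fun c _ => ?_
    rw [Fintype.sum_option, insertSum_ofFn, ← ofFn_extendLeft]
    simp only [← ofFn_extendMiddle]
    rfl

end ListSums

/-! ### Nested products and block elements -/

section Nested

variable {L : Type*} [RightPreLieRing L]

/-- `∑_σ a_{σ(1)} ↶ (a_{σ(2)} ↶ (⋯ ↶ (a_{σ(n)} ↶ y) ⋯))` for a word `S = a₁ ⋯ aₙ`. -/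
def nestSum : ℕ → List L → L → L
  | 0, _, y => y
  | n + 1, S, y => pickSum S fun j S' => j * nestSum n S' y

/-- Permutations are sorted by the value `j` at `0`. The composite sends `0` to `j` and `i.succ` to
`j.succAbove (τ i)`, matching the removal of the `j`-th letter in `pickSum_ofFn`. Injectivity
suffices because the cardinalities agree. -/
theorem sum_perm_fin_succ {M : Type*} [AddCommMonoid M] {n : ℕ}
    (f : Equiv.Perm (Fin (n + 1)) → M) :
    ∑ σ, f σ = ∑ j : Fin (n + 1), ∑ τ : Equiv.Perm (Fin n),
      f (j.cycleRange.symm * Equiv.Perm.decomposeFin.symm (0, τ)) := by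
  rw [← Fintype.sum_prod_type']
  refine (Function.Bijective.sum_comp (e := fun p : Fin (n + 1) × Equiv.Perm (Fin n) =>
    p.1.cycleRange.symm * Equiv.Perm.decomposeFin.symm (0, p.2)) ?_ f).symm
  rw [Fintype.bijective_iff_injective_and_card]
  refine ⟨?_, by simp [Fintype.card_perm, Nat.factorial_succ]⟩
  rintro ⟨j, τ⟩ ⟨j', τ'⟩ h
  have h0 : j = j' := by simpa using congrArg (fun σ => σ 0) h
  subst h0
  have := Equiv.Perm.decomposeFin.symm.injective (mul_left_cancel h)
  simp_all

/-- The letter picked first by `nestSum` is the outermost factor, that is, the value of `σ` at `0`.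
-/
theorem nestSum_ofFn {n : ℕ} (v : Fin n → L) (y : L) :
    nestSum n (List.ofFn v) y =
      ∑ σ : Equiv.Perm (Fin n), (List.ofFn fun i => v (σ i)).foldr (fun a b => a * b) y := by
  induction n with
  | zero => simp [nestSum]
  | succ n ih =>
    rw [nestSum, pickSum_ofFn, sum_perm_fin_succ]
    refine Finset.sum_congr rfl fun j _ => ?_
    rw [ih, Finset.mul_sum]
    refine Finset.sum_congr rfl fun τ _ => ?_
    simp [List.ofFn_succ]

/-- `blockElt` of a word. -/
def blockWord (B : List L) : L := blockElt B.length B.get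

theorem blockWord_ofFn {h : ℕ} (v : Fin h → L) : blockWord (List.ofFn v) = blockElt h v := by
  have key : ∀ {m : ℕ} (e : m = h) (w : Fin m → L), (∀ i, w i = v (i.cast e)) →
      blockElt m w = blockElt h v := by
    rintro m rfl w hw
    exact congrArg _ (funext hw)
  exact key List.length_ofFn _ fun i => List.get_ofFn v i

/-- The last letter of a block is the one that `blockElt` keeps innermost, so removing it leaves a
sum over all orderings of the rest. -/
theorem blockWord_append_singleton (S : List L) (x : L) :
    blockWord (S ++ [x]) = nestSum S.length S x := by
  obtain ⟨n, v, rfl⟩ : ∃ n, ∃ v : Fin n → L, S = List.ofFn v := ⟨_, _, (List.ofFn_get S).symm⟩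
  have e : List.ofFn v ++ [x] = List.ofFn (Fin.snoc v x : Fin (n + 1) → L) := by
    rw [List.ofFn_succ']
    simp
  rw [e, blockWord_ofFn, List.length_ofFn, nestSum_ofFn]
  simp [blockElt]

end Nested

/-! ### The telescoping identity and the expansion over partitions -/

section Expansion

variable (k : Type*) {L : Type*} [CommRing k] [RightPreLieRing L] [RightPreLieAlgebra k L]

theorem rightAct_prod (x : L) (R : List L) :
    rightAct k x (R.map (SymmetricAlgebra.ι k L)).prod =
      pickSum R fun j R' =>
        (R'.map (SymmetricAlgebra.ι k L)).prod * SymmetricAlgebra.ι k L (j * x) := by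
  induction R with
  | nil =>
    rw [List.map_nil, List.prod_nil, ← map_one (algebraMap k (SymmetricAlgebra k L)),
      rightAct_algebraMap]
    rfl
  | cons a R ih =>
    rw [List.map_cons, List.prod_cons, rightAct_mul, rightAct_ι, ih, pickSum, mul_comm]
    congr 1
    have := pickSum_map (AddMonoidHom.mulLeft (SymmetricAlgebra.ι k L a)) R fun j R' =>
        (R'.map (SymmetricAlgebra.ι k L)).prod * SymmetricAlgebra.ι k L (j * x)
    rw [AddMonoidHom.coe_mulLeft] at this
    rw [← this]
    simp only [List.map_cons, List.prod_cons, mul_assoc]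

/-- `l₁ ⋯ lₙ x` as an alternating sum of the products `R ∗ ∑_σ s_{σ(1)} ↶ (⋯ ↶ x)` over all
splittings of `l₁ ⋯ lₙ` into `S` and `R`. -/
theorem splitSum_starMul_nestSum (l : List L) (x : L) :
    splitSum l (fun S R => (-1 : k) ^ S.length •
        starMul k (R.map (SymmetricAlgebra.ι k L)).prod
          (SymmetricAlgebra.ι k L (nestSum S.length S x))) =
      (l.map (SymmetricAlgebra.ι k L)).prod * SymmetricAlgebra.ι k L x := by
  have hpick : ∀ (c : k) (R : List L) (ψ : L → List L → SymmetricAlgebra k L),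
      c • pickSum R ψ = pickSum R fun j R' => c • ψ j R' := fun c R ψ =>
    (pickSum_map (DistribSMul.toAddMonoidHom (SymmetricAlgebra k L) c) R ψ).symm
  simp only [starMul_ι, rightAct_prod, smul_add, hpick]
  -- The derivation terms are reindexed by the splitting in which `j` already lies in `S`; their
  -- sign is then that of `S` with one letter removed.
  rw [splitSum_add, splitSum_pickSum_comm l fun j S R => (-1 : k) ^ S.length •
    ((R.map (SymmetricAlgebra.ι k L)).prod *
      SymmetricAlgebra.ι k L (j * nestSum S.length S x)), ← splitSum_add,
    ← splitSum_ite l fun R => (R.map (SymmetricAlgebra.ι k L)).prod * SymmetricAlgebra.ι k L x]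
  refine splitSum_congr _ _ _ fun S R _ => ?_
  -- For empty `S` there is no letter to pick and the commutative product remains. For nonempty `S`
  -- the picked terms add up to `nestSum` of `S`, with sign opposite to the other term.
  cases S with
  | nil => simp [nestSum, pickSum]
  | cons a S =>
    have h := pickSum_map ((DistribSMul.toAddMonoidHom (SymmetricAlgebra k L)
      ((-1 : k) ^ S.length)).comp ((AddMonoidHom.mulLeft
        (R.map (SymmetricAlgebra.ι k L)).prod).comp
          (SymmetricAlgebra.ι k L).toAddMonoidHom)) (a :: S)
      fun j S' => j * nestSum S.length S' x
    simp only [AddMonoidHom.comp_apply, DistribSMul.toAddMonoidHom_apply,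
      AddMonoidHom.coe_mulLeft, LinearMap.toAddMonoidHom_coe] at h
    rw [pickSum_congr (a :: S) _ (fun j S' => (-1 : k) ^ S.length •
      ((R.map (SymmetricAlgebra.ι k L)).prod *
        SymmetricAlgebra.ι k L (j * nestSum S.length S' x))) (fun j S' hS => by
          rw [show S'.length = S.length by simpa using hS]), h]
    simp only [List.length_cons, List.isEmpty_cons, Bool.false_eq_true, if_false, nestSum, pow_succ,
      mul_neg, mul_one, neg_smul, neg_add_cancel]

theorem starProd_append_singleton (As : List (SymmetricAlgebra k L)) (A : SymmetricAlgebra k L) :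
    starProd k (As ++ [A]) = starMul k (starProd k As) A := by
  simp [starProd]

/-- The induction is strong because the complement `R` of the last block can have any smaller
length. The exponent `n + Bs.length` has the parity of the number of letters minus the number of
blocks and avoids truncated subtraction. As `starProd` is bracketed to the left, appending the last
block is one multiplication on the right. -/
theorem prod_eq_partSum (n : ℕ) : ∀ l : List L, l.length = n →
    (l.map (SymmetricAlgebra.ι k L)).prod = partSum l fun Bs => (-1 : k) ^ (n + Bs.length) •
      starProd k (Bs.map fun B => SymmetricAlgebra.ι k L (blockWord B)) := by
  induction n using Nat.strong_induction_on with
  | _ n ih =>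
  intro l hl
  rcases List.eq_nil_or_concat l with rfl | ⟨l, x, rfl⟩
  · obtain rfl : 0 = n := hl
    simp [partSum, starProd]
  · rw [List.concat_eq_append] at hl ⊢
    rw [List.length_append, List.length_singleton] at hl
    rw [partSum_append_singleton, List.map_append, List.prod_append, List.map_singleton,
      List.prod_singleton, ← splitSum_starMul_nestSum]
    refine splitSum_congr _ _ _ fun S R hSR => ?_
    -- Multiplication by the last block with its sign is additive, so `partSum_map` carries it
    -- through the expansion of `R`.
    let f : SymmetricAlgebra k L →+ SymmetricAlgebra k L :=
      { toFun := fun A => (-1 : k) ^ S.length •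
          starMul k A (SymmetricAlgebra.ι k L (nestSum S.length S x))
        map_zero' := by
          rw [← zero_smul k (0 : SymmetricAlgebra k L), starMul_smul_left, zero_smul, smul_zero,
            zero_smul]
        map_add' := fun A B => by rw [starMul_add_left, smul_add] }
    have hf : ∀ A, f A = (-1 : k) ^ S.length •
        starMul k A (SymmetricAlgebra.ι k L (nestSum S.length S x)) := fun _ => rfl
    rw [← hf, ih R.length (by omega) R rfl, ← partSum_map]
    congr 1
    funext Bs
    rw [hf, starMul_smul_left, smul_smul, List.map_append, List.map_singleton,
      starProd_append_singleton, blockWord_append_singleton, ← pow_add, List.length_append,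
      List.length_singleton]
    congr 1
    -- The excess of 2 comes from the letter `x`, which lies in neither `S` nor `R`, and from the
    -- one additional block.
    rw [show n + (Bs.length + 1) = (S.length + (R.length + Bs.length)) + 2 by omega, pow_add _ _ 2]
    simp

end Expansion

end PreLie

/-- In a right pre-Lie algebra `L`, the product `↶` is written `*`. An `OrderedFinpartition n` is a
partition of `{1, …, n}` into nonempty blocks, listed by increasing maxima, with `P.emb i` the
increasing enumeration of the `i`-th block. -/
theorem proposition2p1 {k L : Type*} [Field k] [CharZero k] [RightPreLieRing L]
    [RightPreLieAlgebra k L] (n : ℕ) (l : Fin n → L) :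
    ∏ i, SymmetricAlgebra.ι k L (l i) =
      ∑ P : OrderedFinpartition n, (-1 : k) ^ (n - P.length) •
        PreLie.starProd k (List.ofFn fun i : Fin P.length =>
          SymmetricAlgebra.ι k L
            (PreLie.blockElt (P.partSize i) fun j => l (P.emb i j))) := by
  rw [← List.prod_ofFn]
  have h := PreLie.prod_eq_partSum k (L := L) n (List.ofFn l) List.length_ofFn
  rw [List.map_ofFn] at h
  refine h.trans ?_
  rw [← PreLie.sum_orderedFinpartition l]
  refine Finset.sum_congr rfl fun P _ => ?_
  rw [List.length_ofFn, List.map_ofFn]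
  congr 1
  -- The bound makes the subtraction genuine; the two exponents then differ by the even number `2 *
  -- P.length`.
  · have := P.length_le
    rw [show n + P.length = (n - P.length) + 2 * P.length by omega, pow_add, pow_mul]
    simp
  · simp only [Function.comp_def, PreLie.blockWord_ofFn]
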